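/- Let $n\ge 1$ and $p\ge 2$. Let $h\in C^2(\mathbb R^n)$ be nonnegative and positively homogeneous of degree $p$, and suppose that there are constants $\lambda,\Lambda>0$ such that $$\lambda|v|^2\le\langle D^2h(x)v,v\rangle\le\Lambda|v|^2\qquad\text{for all }x\in S^{n-1},\ v\in\mathbb R^n .$$ Let $T:\mathbb R^n\to\mathcal P(\mathbb R^n)$ be a multivalued map that is $h$-monotone, that is, $$h(x-\xi)+h(y-\zeta)\le h(x-\zeta)+h(y-\xi)\qquad\text{for all }x,y\in\mathbb R^n,\ \xi\in T(x),\ \zeta\in T(y),$$ and let $T\in L^{p-1}_{\mathrm{loc}}(\mathbb R^n)$, in the sense that some $f\in L^{p-1}_{\mathrm{loc}}(\mathbb R^n;\mathbb R^n)$ satisfies $f(x)\in T(x)$ for a.e. $x$. Let $A\in\mathbb R^{n\times n}$ with operator norm $\|A\|$, $b\in\mathbb R^n$, $0<\beta<1$, and write $u(x)=Tx-Ax-b$; in integrals $Tx$ means $f(x)$, and $\sup_{B_{\beta R}(x_0)}|u|$ is the supremum of $|\xi-Ax-b|$ over all $x\in B_{\beta R}(x_0)$ and all $\xi\in T(x)$.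 Then for all $x_0\in\mathbb R^n$ and $R>0$ $$\sup_{B_{\beta R}(x_0)}|u|\le \begin{cases} K_1R\left(R^{-(p-1)}M_R\right)^{1/(n+p-1)}&\text{if }\left(M_R\right)^{1/(p-1)}\le C(n,p,\beta)R,\\[4pt] K_2R\left(R^{-(p-1)}M_R\right)^{1/(p-1)}&\text{if }\left(M_R\right)^{1/(p-1)}\ge C(n,p,\beta)R, \end{cases}$$ where $M_R=\frac1{|B_R(x_0)|}\int_{B_R(x_0)}|u(x)|^{p-1}\,dx$, the constant $C(n,p,\beta)>0$ depends only on $n,p,\beta$, the constant $K_1$ depends only on $n,p,\lambda,\Lambda,\|A\|$, and $K_2$ depends only on $n,p,\lambda,\Lambda,\|A\|,\beta$. -/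

import Mathlib

open MeasureTheory

/-- `h` is a cost of degree `p` with ellipticity constants `lam`, `Lam`: it is of class `C²`,
nonnegative, positively homogeneous of degree `p`, and its Hessian satisfies
`lam |v|² ≤ ⟨D²h(x) v, v⟩ ≤ Lam |v|²` for all unit vectors `x` and all vectors `v`. -/
structure IsEllipticCost {n : ℕ} (p lam Lam : ℝ) (h : EuclideanSpace ℝ (Fin n) → ℝ) : Prop where
  contDiff : ContDiff ℝ 2 h
  nonneg : ∀ x, 0 ≤ h x
  homogeneous : ∀ t : ℝ, 0 < t → ∀ x, h (t • x) = t ^ p * h x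
  lam_pos : 0 < lam
  Lam_pos : 0 < Lam
  le_hessian : ∀ x v : EuclideanSpace ℝ (Fin n), ‖x‖ = 1 →
    lam * ‖v‖ ^ 2 ≤ fderiv ℝ (fderiv ℝ h) x v v
  hessian_le : ∀ x v : EuclideanSpace ℝ (Fin n), ‖x‖ = 1 →
    fderiv ℝ (fderiv ℝ h) x v v ≤ Lam * ‖v‖ ^ 2

/-- The multivalued map `T` is `h`-monotone. Its domain is the set of `x` with `T x` nonempty. -/
def HMonotone {n : ℕ} (h : EuclideanSpace ℝ (Fin n) → ℝ)
    (T : EuclideanSpace ℝ (Fin n) → Set (EuclideanSpace ℝ (Fin n))) : Prop :=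
  ∀ x y, ∀ ξ ∈ T x, ∀ ζ ∈ T y, h (x - ξ) + h (y - ζ) ≤ h (x - ζ) + h (y - ξ)

/-- The multivalued map `T` belongs to `L^q_loc(ℝⁿ)`, represented by the function `f`: at almost
every point `f` is a value of `T`, and `f` is in `L^q` on every compact set. When `T` is
single-valued almost everywhere, `f` is its almost everywhere unique value. -/
def IsLocLpRepresentative {n : ℕ} (q : ℝ)
    (T : EuclideanSpace ℝ (Fin n) → Set (EuclideanSpace ℝ (Fin n)))
    (f : EuclideanSpace ℝ (Fin n) → EuclideanSpace ℝ (Fin n)) : Prop :=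
  (∀ᵐ x, f x ∈ T x) ∧
    ∀ K : Set (EuclideanSpace ℝ (Fin n)), IsCompact K →
      MemLp f (ENNReal.ofReal q) (volume.restrict K)

/-! Fix `ξ ∈ T y` with deviation `U = ξ - L y - b ≠ 0`, and let `G` be the increment of `∇h` from `w
= y - ξ` to `w + U`. With `s = ‖w‖ + ‖U‖`, ellipticity and homogeneity give `‖G‖ ≳ s ^ (p - 2) *
‖U‖`. Let `x` lie at distance about `r` from `y`, roughly in the direction where `G` is largest. For
`ζ ∈ T x`, `h`-monotonicity bounds `G (x - y)` by Taylor errors of size `s ^ (p - 2) * (‖ζ - L y -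
b‖ + r) * r`, unless `‖U‖` is already `≲ ‖ζ - L y - b‖ + r`. The degenerate weight `s ^ (p - 2)`
cancels, so `‖U‖ ≲ ‖ζ - L x - b‖ + r` on a whole ball of radius `r / 2`
(`HMonotone.exists_direction_norm_le`).

Averaging the power `p - 1` over that ball bounds `‖U‖` by the larger of `r` and `((2R / r) ^ n *
avg) ^ (1 / (p - 1))`, up to a constant (`HMonotone.norm_le_max`). The two regimes arise from
optimizing `r`: either the two terms balance at an admissible radius, or the largest admissible
radius is used. -/

namespace IsEllipticCost

variable {n : ℕ} {p lam Lam : ℝ} {h : EuclideanSpace ℝ (Fin n) → ℝ}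

/-! ### Hessian of a homogeneous elliptic cost -/

theorem differentiable (H : IsEllipticCost p lam Lam h) : Differentiable ℝ h :=
  H.contDiff.differentiable (by norm_num)

theorem contDiff_fderiv (H : IsEllipticCost p lam Lam h) : ContDiff ℝ 1 (fderiv ℝ h) :=
  H.contDiff.fderiv_right (by norm_num)

theorem differentiable_fderiv (H : IsEllipticCost p lam Lam h) :
    Differentiable ℝ (fderiv ℝ h) :=
  H.contDiff_fderiv.differentiable (by norm_num)

theorem continuous_hessian_apply (H : IsEllipticCost p lam Lam h)
    (v : EuclideanSpace ℝ (Fin n)) : Continuous fun x => fderiv ℝ (fderiv ℝ h) x v v :=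
  ((H.contDiff_fderiv.continuous_fderiv (by norm_num)).clm_apply continuous_const).clm_apply
    continuous_const

theorem smul_fderiv_smul (H : IsEllipticCost p lam Lam h) {t : ℝ} (ht : 0 < t)
    (x : EuclideanSpace ℝ (Fin n)) : t • fderiv ℝ h (t • x) = t ^ p • fderiv ℝ h x := by
  have e : (fun y => h (t • y)) = fun y => t ^ p • h y := by
    funext y; rw [H.homogeneous t ht y, smul_eq_mul]
  rw [← fderiv_comp_smul, e, fderiv_fun_const_smul (H.differentiable x)]

theorem sq_smul_hessian_smul (H : IsEllipticCost p lam Lam h) {t : ℝ} (ht : 0 < t)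
    (x : EuclideanSpace ℝ (Fin n)) :
    t ^ 2 • fderiv ℝ (fderiv ℝ h) (t • x) = t ^ p • fderiv ℝ (fderiv ℝ h) x := by
  have e : (fun y => t • fderiv ℝ h (t • y)) = fun y => t ^ p • fderiv ℝ h y :=
    funext fun y => H.smul_fderiv_smul ht y
  have hd : DifferentiableAt ℝ (fun y => fderiv ℝ h (t • y)) x :=
    (H.differentiable_fderiv (t • x)).fun_comp' x (differentiableAt_id.const_smul t)
  rw [← fderiv_fun_const_smul (H.differentiable_fderiv x), ← e, fderiv_fun_const_smul hd,
    fderiv_comp_smul, smul_smul, sq]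

theorem hessian_eq_smul (H : IsEllipticCost p lam Lam h) {x : EuclideanSpace ℝ (Fin n)}
    (hx : x ≠ 0) :
    fderiv ℝ (fderiv ℝ h) x =
      ‖x‖ ^ (p - 2) • fderiv ℝ (fderiv ℝ h) (‖x‖⁻¹ • x) := by
  have hx' : 0 < ‖x‖ := norm_pos_iff.2 hx
  have e := H.sq_smul_hessian_smul hx' (‖x‖⁻¹ • x)
  rw [smul_inv_smul₀ hx'.ne'] at e
  rw [Real.rpow_sub hx', Real.rpow_two, div_eq_inv_mul, ← smul_smul, ← e,
    inv_smul_smul₀ (pow_ne_zero 2 hx'.ne')]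

theorem hessian_bounds (H : IsEllipticCost p lam Lam h) (hp : 2 ≤ p)
    (x v : EuclideanSpace ℝ (Fin n)) :
    lam * ‖x‖ ^ (p - 2) * ‖v‖ ^ 2 ≤ fderiv ℝ (fderiv ℝ h) x v v ∧
      fderiv ℝ (fderiv ℝ h) x v v ≤ Lam * ‖x‖ ^ (p - 2) * ‖v‖ ^ 2 := by
  rcases eq_or_ne v 0 with rfl | hv
  · simp
  have : Nontrivial (EuclideanSpace ℝ (Fin n)) := ⟨v, 0, hv⟩
  have hc : Continuous fun x : EuclideanSpace ℝ (Fin n) => ‖x‖ ^ (p - 2) :=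
    continuous_norm.rpow_const fun _ => Or.inr (by linarith)
  have hD := H.continuous_hessian_apply v
  -- Scaling to the unit sphere only works away from the origin; the origin follows by density and
  -- continuity, since `p ≥ 2`.
  refine (IsClosed.inter
    (isClosed_le ((hc.const_mul lam).mul_const (‖v‖ ^ 2)) hD)
    (isClosed_le hD ((hc.const_mul Lam).mul_const (‖v‖ ^ 2)))).closure_subset_iff.2 ?_
    (dense_compl_singleton (0 : EuclideanSpace ℝ (Fin n)) x)
  intro z hz
  have hz' : 0 < ‖z‖ := norm_pos_iff.2 hz
  have hu : ‖‖z‖⁻¹ • z‖ = 1 := norm_smul_inv_norm (𝕜 := ℝ) hz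
  have hpow : 0 ≤ ‖z‖ ^ (p - 2) := Real.rpow_nonneg hz'.le _
  constructor
  · have := mul_le_mul_of_nonneg_left (H.le_hessian _ v hu) hpow
    change _ ≤ fderiv ℝ (fderiv ℝ h) z v v
    rw [H.hessian_eq_smul hz]
    simp only [smul_apply, smul_eq_mul]
    linarith
  · have := mul_le_mul_of_nonneg_left (H.hessian_le _ v hu) hpow
    change fderiv ℝ (fderiv ℝ h) z v v ≤ _
    rw [H.hessian_eq_smul hz]
    simp only [smul_apply, smul_eq_mul]
    linarith

theorem norm_hessian_le (H : IsEllipticCost p lam Lam h) (hp : 2 ≤ p)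
    (x : EuclideanSpace ℝ (Fin n)) :
    ‖fderiv ℝ (fderiv ℝ h) x‖ ≤ Lam * ‖x‖ ^ (p - 2) := by
  have hc : 0 ≤ ‖x‖ ^ (p - 2) := Real.rpow_nonneg (norm_nonneg x) _
  have hL : 0 ≤ Lam * ‖x‖ ^ (p - 2) := mul_nonneg H.Lam_pos.le hc
  refine ContinuousLinearMap.opNorm_le_bound _ hL fun v =>
    ContinuousLinearMap.opNorm_le_bound _ (by positivity) fun w => ?_
  have hs : IsSymmSndFDerivAt ℝ h x := H.contDiff.contDiffAt.isSymmSndFDerivAt (by simp)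
  let B : EuclideanSpace ℝ (Fin n) →ₗ[ℝ] EuclideanSpace ℝ (Fin n) →ₗ[ℝ] ℝ :=
    LinearMap.mk₂ ℝ (fun v w => fderiv ℝ (fderiv ℝ h) x v w)
      (by simp) (by simp) (by simp) (by simp)
  have hB : ∀ v, 0 ≤ B v v := fun v =>
    le_trans (mul_nonneg (mul_nonneg H.lam_pos.le hc) (sq_nonneg _)) (H.hessian_bounds hp x v).1
  -- Cauchy–Schwarz for the positive semidefinite form `B` turns the bound on its diagonal into an
  -- operator norm bound.
  have hcs := LinearMap.BilinForm.apply_mul_apply_le_of_forall_zero_le B hB v w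
  have hsym : B w v = B v w := hs.eq w v
  rw [hsym] at hcs
  have h1 : B v v ≤ Lam * ‖x‖ ^ (p - 2) * ‖v‖ ^ 2 := (H.hessian_bounds hp x v).2
  have h2 : B w w ≤ Lam * ‖x‖ ^ (p - 2) * ‖w‖ ^ 2 := (H.hessian_bounds hp x w).2
  have h3 : B v w ^ 2 ≤ (Lam * ‖x‖ ^ (p - 2) * ‖v‖ * ‖w‖) ^ 2 := by
    calc B v w ^ 2 ≤ B v v * B w w := by rw [sq]; exact hcs
      _ ≤ (Lam * ‖x‖ ^ (p - 2) * ‖v‖ ^ 2) * (Lam * ‖x‖ ^ (p - 2) * ‖w‖ ^ 2) :=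
        mul_le_mul h1 h2 (hB w) (by positivity)
      _ = _ := by ring
  exact abs_le_of_sq_le_sq h3 (by positivity)

/-! ### Gradient increments and Taylor errors -/

theorem norm_fderiv_sub_le (H : IsEllipticCost p lam Lam h) (hp : 2 ≤ p)
    {a b : EuclideanSpace ℝ (Fin n)} {N : ℝ} (ha : ‖a‖ ≤ N) (hb : ‖b‖ ≤ N) :
    ‖fderiv ℝ h a - fderiv ℝ h b‖ ≤ Lam * N ^ (p - 2) * ‖a - b‖ := by
  refine (convex_closedBall (0 : EuclideanSpace ℝ (Fin n)) N).norm_image_sub_le_of_norm_fderiv_le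
    (𝕜 := ℝ) (fun x _ => H.differentiable_fderiv x) (fun x hx => ?_)
    (mem_closedBall_zero_iff.2 hb) (mem_closedBall_zero_iff.2 ha)
  refine (H.norm_hessian_le hp x).trans (mul_le_mul_of_nonneg_left ?_ H.Lam_pos.le)
  exact Real.rpow_le_rpow (norm_nonneg x) (mem_closedBall_zero_iff.1 hx) (by linarith)

theorem abs_sub_sub_fderiv_le (H : IsEllipticCost p lam Lam h) (hp : 2 ≤ p)
    {a d : EuclideanSpace ℝ (Fin n)} {N : ℝ} (hN : ‖a‖ + ‖d‖ ≤ N) :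
    |h (a + d) - h a - fderiv ℝ h a d| ≤ Lam * N ^ (p - 2) * ‖d‖ * ‖d‖ := by
  have ha : ‖a‖ ≤ N := by linarith [norm_nonneg d]
  have hN0 : 0 ≤ N := (norm_nonneg a).trans ha
  have := (convex_closedBall (0 : EuclideanSpace ℝ (Fin n)) N).inter
    (convex_closedBall a ‖d‖) |>.norm_image_sub_le_of_norm_fderiv_le' (𝕜 := ℝ)
    (f := h) (φ := fderiv ℝ h a) (C := Lam * N ^ (p - 2) * ‖d‖) (x := a) (y := a + d)
    (fun x _ => H.differentiable x) (fun x hx => ?_) ?_ ?_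
  · simpa using this
  · refine (H.norm_fderiv_sub_le hp (mem_closedBall_zero_iff.1 hx.1) ha).trans ?_
    have h2 : ‖x - a‖ ≤ ‖d‖ := by simpa [dist_eq_norm] using hx.2
    have := Real.rpow_nonneg hN0 (p - 2)
    have := H.Lam_pos.le
    gcongr
  · simp [ha]
  · exact ⟨mem_closedBall_zero_iff.2 ((norm_add_le _ _).trans hN), by simp⟩

/-- The Hessian may degenerate where the segment from `w` to `w + U` passes near the origin. But the
segment cannot be near the origin in both its first and its last quarter, so on one of these the
weight is at least `(s / 7) ^ (p - 2)`; the rest contributes nonnegatively. -/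
theorem le_fderiv_sub_apply (H : IsEllipticCost p lam Lam h) (hp : 2 ≤ p)
    (w U : EuclideanSpace ℝ (Fin n)) :
    lam / 4 * ((‖w‖ + ‖U‖) / 7) ^ (p - 2) * ‖U‖ ^ 2 ≤
      (fderiv ℝ h (w + U) - fderiv ℝ h w) U := by
  set s := ‖w‖ + ‖U‖ with hs
  have hs0 : 0 ≤ s := by positivity
  set φ : ℝ → ℝ := fun t => fderiv ℝ h (w + t • U) U with hφ
  have hline : ∀ t : ℝ, HasDerivAt (fun t : ℝ => w + t • U) U t := fun t => by
    simpa using ((hasDerivAt_id t).smul_const U).const_add w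
  have hderiv : ∀ t, HasDerivAt φ (fderiv ℝ (fderiv ℝ h) (w + t • U) U U) t := fun t => by
    have := (H.differentiable_fderiv (w + t • U)).hasFDerivAt.comp_hasDerivAt t (hline t)
    simpa using this.clm_apply (hasDerivAt_const t U)
  have hlow : ∀ t, lam * ‖w + t • U‖ ^ (p - 2) * ‖U‖ ^ 2 ≤ deriv φ t := fun t => by
    rw [(hderiv t).deriv]; exact (H.hessian_bounds hp _ _).1
  have hdiff : Differentiable ℝ φ := fun t => (hderiv t).differentiableAt
  have hlam := H.lam_pos
  have hmono : Monotone φ := monotone_of_deriv_nonneg hdiff fun t =>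
    le_trans (by positivity) (hlow t)
  have key : ∀ a b : ℝ, a ≤ b → (∀ t ∈ Set.Icc a b, s / 7 ≤ ‖w + t • U‖) →
      lam * (s / 7) ^ (p - 2) * ‖U‖ ^ 2 * (b - a) ≤ φ b - φ a := fun a b hab ht =>
    (convex_Icc a b).mul_sub_le_image_sub_of_le_deriv hdiff.continuous.continuousOn
      hdiff.differentiableOn (fun t hti => le_trans (by
        have := ht t (interior_subset hti)
        gcongr) (hlow t)) a (Set.left_mem_Icc.2 hab) b (Set.right_mem_Icc.2 hab) hab
  have hgoal : (fderiv ℝ h (w + U) - fderiv ℝ h w) U = φ 1 - φ 0 := by simp [hφ]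
  rw [hgoal]
  by_cases h1 : ∀ t ∈ Set.Icc (0 : ℝ) (1 / 4), s / 7 ≤ ‖w + t • U‖
  · linarith [key 0 (1 / 4) (by norm_num) h1, hmono (show (1 / 4 : ℝ) ≤ 1 by norm_num)]
  by_cases h2 : ∀ t ∈ Set.Icc (3 / 4 : ℝ) 1, s / 7 ≤ ‖w + t • U‖
  · linarith [key (3 / 4) 1 (by norm_num) h2, hmono (show (0 : ℝ) ≤ 3 / 4 by norm_num)]
  exfalso
  push Not at h1 h2
  obtain ⟨t₁, ht₁, hlt₁⟩ := h1
  obtain ⟨t₂, ht₂, hlt₂⟩ := h2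
  -- Two points of norm below `s / 7`, at parameters at least `1 / 2` apart, give `‖U‖ < 4s / 7`;
  -- then `‖w‖ < s / 7 + ‖U‖ / 4 < 2s / 7`, contradicting `s = ‖w‖ + ‖U‖`.
  have e1 : (t₂ - t₁) * ‖U‖ ≤ ‖w + t₂ • U‖ + ‖w + t₁ • U‖ := by
    rw [← Real.norm_of_nonneg (show 0 ≤ t₂ - t₁ by linarith [ht₁.2, ht₂.1]), ← norm_smul]
    rw [show (t₂ - t₁) • U = w + t₂ • U - (w + t₁ • U) by module]
    exact norm_sub_le _ _
  have e2 : ‖w‖ ≤ ‖w + t₁ • U‖ + t₁ * ‖U‖ := by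
    rw [← Real.norm_of_nonneg ht₁.1, ← norm_smul]
    simpa [Real.norm_of_nonneg ht₁.1] using norm_sub_le (w + t₁ • U) (t₁ • U)
  have e3 : 1 / 2 * ‖U‖ ≤ (t₂ - t₁) * ‖U‖ :=
    mul_le_mul_of_nonneg_right (by linarith [ht₁.2, ht₂.1]) (norm_nonneg U)
  have e4 : t₁ * ‖U‖ ≤ 1 / 4 * ‖U‖ := mul_le_mul_of_nonneg_right ht₁.2 (norm_nonneg U)
  linarith

end IsEllipticCost

/-! ### Pointwise comparison of deviations -/

theorem ContinuousLinearMap.exists_norm_eq_one_apply_eq_norm {E : Type*} [NormedAddCommGroup E]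
    [InnerProductSpace ℝ E] [CompleteSpace E] {G : E →L[ℝ] ℝ} (hG : G ≠ 0) :
    ∃ e : E, ‖e‖ = 1 ∧ G e = ‖G‖ := by
  set g := (InnerProductSpace.toDual ℝ E).symm G with hg
  have hgn : ‖g‖ = ‖G‖ := LinearIsometryEquiv.norm_map _ _
  have hG0 : ‖G‖ ≠ 0 := norm_ne_zero_iff.2 hG
  refine ⟨‖G‖⁻¹ • g, ?_, ?_⟩
  · rw [norm_smul, norm_inv, norm_norm, hgn, inv_mul_cancel₀ hG0]
  · have : G g = ‖G‖ * ‖G‖ := by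
      rw [← InnerProductSpace.toDual_symm_apply, ← hg, real_inner_self_eq_norm_mul_norm, hgn]
    rw [map_smul, smul_eq_mul, this, inv_mul_cancel_left₀ hG0]

/-- The constant in the pointwise comparison of the deviations of an `h`-monotone map from an
affine map whose linear part has norm `a`. -/
noncomputable def deviationConst (p lam Lam a : ℝ) : ℝ :=
  (1 + 16 * Lam * 14 ^ (p - 2) / lam) * (4 + 2 * a)

theorem deviationConst_pos {p lam Lam a : ℝ} (hlam : 0 < lam) (hLam : 0 < Lam) (ha : 0 ≤ a) :
    0 < deviationConst p lam Lam a := by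
  unfold deviationConst; positivity

section

variable {n : ℕ} {p lam Lam : ℝ} {h : EuclideanSpace ℝ (Fin n) → ℝ}

/-- To first order `hmono` says that the gradient increment from `w` to `w + U - c` is nonpositive
on `d`, whereas `hdir` makes the increment up to `w + U` large on `d`. The discrepancy is paid for
by `c` and by second-order terms in `d`. -/
theorem IsEllipticCost.norm_le_of_four_point (H : IsEllipticCost p lam Lam h) (hp : 2 ≤ p)
    {w U d c : EuclideanSpace ℝ (Fin n)} {r : ℝ} (hU : U ≠ 0) (hr : 0 < r) (hd : ‖d‖ ≤ 2 * r)
    (hdir : ‖fderiv ℝ h (w + U) - fderiv ℝ h w‖ * (r / 2) ≤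
      (fderiv ℝ h (w + U) - fderiv ℝ h w) d)
    (hmono : h (w + U - c + d) + h w ≤ h (w + d) + h (w + U - c)) :
    ‖U‖ ≤ (1 + 16 * Lam * 14 ^ (p - 2) / lam) * (‖c‖ + 4 * r) := by
  have hlam := H.lam_pos
  have hLam := H.Lam_pos
  have hK : 0 ≤ 16 * Lam * 14 ^ (p - 2) / lam := by positivity
  -- If `‖U‖` is small the claim is immediate; otherwise `‖c‖ + ‖d‖ ≤ ‖U‖`, which keeps every point
  -- in the Taylor estimates within the ball of radius `2 * s`.
  rcases le_total ‖U‖ (‖c‖ + 2 * r) with hle | hle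
  · nlinarith [mul_nonneg hK (show 0 ≤ ‖c‖ + 4 * r by positivity)]
  set G := fderiv ℝ h (w + U) - fderiv ℝ h w with hG
  set s := ‖w‖ + ‖U‖ with hs
  have hUpos : 0 < ‖U‖ := norm_pos_iff.2 hU
  have hspos : 0 < s := by positivity
  set σ := (s / 7) ^ (p - 2) with hσ
  have hσpos : 0 < σ := by positivity
  -- Upper and lower weights differ only by this factor, so `σ` cancels in `t7`.
  have hN : (2 * s) ^ (p - 2) = 14 ^ (p - 2) * σ := by
    rw [hσ, ← Real.mul_rpow (by norm_num) (by positivity)]; congr 1; ring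
  have hGlow : lam / 4 * σ * ‖U‖ ≤ ‖G‖ := by
    have h1 := H.le_fderiv_sub_apply hp w U
    have h2 : G U ≤ ‖G‖ * ‖U‖ := (le_abs_self _).trans (G.le_opNorm U)
    refine le_of_mul_le_mul_right ?_ hUpos
    calc lam / 4 * σ * ‖U‖ * ‖U‖ = lam / 4 * σ * ‖U‖ ^ 2 := by ring
      _ ≤ _ := h1.trans h2
  have hw' : ‖w + U - c‖ ≤ s + ‖c‖ := (norm_sub_le _ _).trans (by gcongr; exact norm_add_le _ _)
  have hwU : ‖w + U‖ ≤ s := norm_add_le _ _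
  have hwn := norm_nonneg w
  have hcn := norm_nonneg c
  have t1 := H.abs_sub_sub_fderiv_le hp (a := w) (d := d) (N := 2 * s) (by linarith)
  have t2 := H.abs_sub_sub_fderiv_le hp (a := w + U - c) (d := d) (N := 2 * s) (by linarith)
  have t3 := H.norm_fderiv_sub_le hp (a := w + U) (b := w + U - c) (N := 2 * s)
    (by linarith) (by linarith)
  rw [sub_sub_cancel] at t3
  have t4 : (fderiv ℝ h (w + U) - fderiv ℝ h (w + U - c)) d ≤
      Lam * (2 * s) ^ (p - 2) * ‖c‖ * ‖d‖ :=
    (le_abs_self _).trans ((ContinuousLinearMap.le_opNorm _ d).trans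
      (mul_le_mul_of_nonneg_right t3 (norm_nonneg d)))
  have t5 : G d ≤ Lam * (2 * s) ^ (p - 2) * (‖c‖ + 2 * ‖d‖) * ‖d‖ := by
    simp only [hG, sub_apply] at t4 ⊢
    linarith [(abs_le.1 t1).2, (abs_le.1 t2).1]
  have t6 : lam / 4 * σ * ‖U‖ * (r / 2) ≤
      Lam * (14 ^ (p - 2) * σ) * (‖c‖ + 4 * r) * (2 * r) :=
    calc lam / 4 * σ * ‖U‖ * (r / 2) ≤ ‖G‖ * (r / 2) := by gcongr
      _ ≤ Lam * (14 ^ (p - 2) * σ) * (‖c‖ + 2 * ‖d‖) * ‖d‖ := hN ▸ hdir.trans t5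
      _ ≤ Lam * (14 ^ (p - 2) * σ) * (‖c‖ + 2 * (2 * r)) * (2 * r) := by gcongr
      _ = _ := by ring
  have t7 : lam * ‖U‖ ≤ 16 * Lam * 14 ^ (p - 2) * (‖c‖ + 4 * r) := by
    refine le_of_mul_le_mul_right ?_ (show 0 < σ * r / 8 by positivity)
    linarith
  have t8 : ‖U‖ ≤ 16 * Lam * 14 ^ (p - 2) / lam * (‖c‖ + 4 * r) := by
    rw [div_mul_eq_mul_div, le_div_iff₀ hlam]; linarith
  linarith

theorem HMonotone.exists_direction_norm_le
    {T : EuclideanSpace ℝ (Fin n) → Set (EuclideanSpace ℝ (Fin n))} (hT : HMonotone h T)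
    (H : IsEllipticCost p lam Lam h) (hp : 2 ≤ p)
    (L : EuclideanSpace ℝ (Fin n) →L[ℝ] EuclideanSpace ℝ (Fin n))
    (b : EuclideanSpace ℝ (Fin n)) {y ξ : EuclideanSpace ℝ (Fin n)} (hξ : ξ ∈ T y)
    (hU : ξ - L y - b ≠ 0) :
    ∃ e : EuclideanSpace ℝ (Fin n), ‖e‖ = 1 ∧
      ∀ r : ℝ, 0 < r → ∀ x ∈ Metric.ball (y + r • e) (r / 2), ∀ ζ ∈ T x,
        ‖ξ - L y - b‖ ≤ deviationConst p lam Lam ‖L‖ * (‖ζ - L x - b‖ + r) := by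
  set U := ξ - L y - b with hUdef
  set G := fderiv ℝ h (y - ξ + U) - fderiv ℝ h (y - ξ) with hG
  have hlam := H.lam_pos
  have hLam := H.Lam_pos
  have hG0 : G ≠ 0 := fun h0 => by
    have h1 := H.le_fderiv_sub_apply hp (y - ξ) U
    rw [← hG, h0] at h1
    have : 0 < ‖U‖ := norm_pos_iff.2 hU
    have : 0 < lam / 4 * ((‖y - ξ‖ + ‖U‖) / 7) ^ (p - 2) * ‖U‖ ^ 2 := by positivity
    simp only [zero_apply] at h1
    linarith
  obtain ⟨e, he, hGe⟩ := ContinuousLinearMap.exists_norm_eq_one_apply_eq_norm hG0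
  refine ⟨e, he, fun r hr x hx ζ hζ => ?_⟩
  have hx' : ‖x - y - r • e‖ ≤ r / 2 := by
    rw [sub_sub]; exact (mem_ball_iff_norm.1 hx).le
  have hre : ‖r • e‖ = r := by rw [norm_smul, he, mul_one, Real.norm_of_nonneg hr.le]
  have hd : ‖x - y‖ ≤ 2 * r := by
    have := norm_add_le (x - y - r • e) (r • e)
    rw [sub_add_cancel] at this
    linarith
  have hdir : ‖G‖ * (r / 2) ≤ G (x - y) := by
    have h1 : |G (x - y - r • e)| ≤ ‖G‖ * (r / 2) :=
      (G.le_opNorm _).trans (by gcongr)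
    have h2 : G (x - y) = G (x - y - r • e) + r * ‖G‖ := by simp [hGe]
    linarith [(abs_le.1 h1).1]
  -- Here `c = ζ - L y - b`, chosen so that `y - ξ + U - c = y - ζ`; passing from `L y` to `L x`
  -- costs at most `2 * r * ‖L‖`.
  set c := ζ - L x - b + L (x - y) with hc
  have e1 : y - ξ + U - c = y - ζ := by rw [hc, hUdef, map_sub]; abel
  have e2 : y - ξ + U - c + (x - y) = x - ζ := by rw [e1]; abel
  have e3 : y - ξ + (x - y) = x - ξ := by abel
  have hmono : h (y - ξ + U - c + (x - y)) + h (y - ξ) ≤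
      h (y - ξ + (x - y)) + h (y - ξ + U - c) := by
    rw [e2, e3, e1]; exact hT x y ζ hζ ξ hξ
  have hmain := H.norm_le_of_four_point hp hU hr hd hdir hmono
  have hcn : ‖c‖ ≤ ‖ζ - L x - b‖ + ‖L‖ * (2 * r) :=
    (norm_add_le _ _).trans (by gcongr; exact L.le_opNorm_of_le hd)
  unfold deviationConst
  rw [mul_assoc]
  refine hmain.trans (mul_le_mul_of_nonneg_left ?_ (by positivity))
  nlinarith [norm_nonneg (ζ - L x - b), mul_nonneg (norm_nonneg L) (norm_nonneg (ζ - L x - b))]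

/-! ### From pointwise comparison to averages -/

theorem le_mul_setAverage_ball {g : EuclideanSpace ℝ (Fin n) → ℝ} (hg : ∀ x, 0 ≤ g x)
    {x₀ z : EuclideanSpace ℝ (Fin n)} {R s c : ℝ} (hs : 0 < s) (hR : 0 < R)
    (hint : IntegrableOn g (Metric.ball x₀ R)) (hsub : Metric.ball z s ⊆ Metric.ball x₀ R)
    (hc : ∀ᵐ x, x ∈ Metric.ball z s → c ≤ g x) :
    c ≤ (R / s) ^ n * ⨍ x in Metric.ball x₀ R, g x := by
  have hvol : ∀ (x : EuclideanSpace ℝ (Fin n)) (t : ℝ), 0 < t →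
      volume.real (Metric.ball x t) =
        t ^ n * volume.real (Metric.ball (0 : EuclideanSpace ℝ (Fin n)) 1) := fun x t ht => by
    rw [measureReal_def, Measure.addHaar_ball_of_pos _ _ ht, ENNReal.toReal_mul,
      ENNReal.toReal_ofReal (by positivity), finrank_euclideanSpace_fin, measureReal_def]
  set κ := volume.real (Metric.ball (0 : EuclideanSpace ℝ (Fin n)) 1) with hκdef
  have hκ : 0 < κ :=
    ENNReal.toReal_pos (Metric.measure_ball_pos _ _ one_pos).ne' measure_ball_lt_top.ne
  have h1 : volume.real (Metric.ball z s) * c ≤ ∫ x in Metric.ball z s, g x := by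
    rw [← smul_eq_mul, ← setIntegral_const c]
    exact setIntegral_mono_on_ae (integrableOn_const measure_ball_lt_top.ne)
      (hint.mono_set hsub) measurableSet_ball hc
  have h2 : ∫ x in Metric.ball z s, g x ≤ ∫ x in Metric.ball x₀ R, g x :=
    setIntegral_mono_set hint (Filter.Eventually.of_forall hg) hsub.eventuallyLE
  rw [setAverage_eq, smul_eq_mul, hvol x₀ R hR, div_pow]
  rw [hvol z s hs] at h1
  have h3 : R ^ n / s ^ n * ((R ^ n * κ)⁻¹ * ∫ x in Metric.ball x₀ R, g x) =
      (∫ x in Metric.ball x₀ R, g x) / (s ^ n * κ) := by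
    field_simp
  rw [h3, le_div_iff₀ (by positivity)]
  linarith

theorem IsLocLpRepresentative.integrableOn_rpow_norm
    {T : EuclideanSpace ℝ (Fin n) → Set (EuclideanSpace ℝ (Fin n))}
    {f : EuclideanSpace ℝ (Fin n) → EuclideanSpace ℝ (Fin n)} {q : ℝ}
    (hf : IsLocLpRepresentative q T f) (hq : 0 < q)
    (L : EuclideanSpace ℝ (Fin n) →L[ℝ] EuclideanSpace ℝ (Fin n))
    (b x₀ : EuclideanSpace ℝ (Fin n)) (R : ℝ) :
    IntegrableOn (fun x => ‖f x - L x - b‖ ^ q) (Metric.ball x₀ R) := by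
  have hK := isCompact_closedBall x₀ R
  have : IsFiniteMeasure (volume.restrict (Metric.closedBall x₀ R)) :=
    ⟨by simpa using hK.measure_lt_top⟩
  have hcont : Continuous fun x => L x + b := by fun_prop
  obtain ⟨D, hD⟩ := hK.exists_bound_of_continuousOn hcont.continuousOn
  have h1 : MemLp (fun x => L x + b) (ENNReal.ofReal q)
      (volume.restrict (Metric.closedBall x₀ R)) :=
    MemLp.of_bound hcont.aestronglyMeasurable D
      ((ae_restrict_iff' Metric.isClosed_closedBall.measurableSet).2 (Filter.Eventually.of_forall hD))
  have h2 := ((hf.2 _ hK).sub h1).integrable_norm_rpow'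
  rw [ENNReal.toReal_ofReal hq.le] at h2
  refine IntegrableOn.mono_set ?_ Metric.ball_subset_closedBall
  simpa only [IntegrableOn, Pi.sub_apply, sub_sub] using h2

theorem HMonotone.norm_le_max
    {T : EuclideanSpace ℝ (Fin n) → Set (EuclideanSpace ℝ (Fin n))}
    {f : EuclideanSpace ℝ (Fin n) → EuclideanSpace ℝ (Fin n)} (hT : HMonotone h T)
    (H : IsEllipticCost p lam Lam h) (hp : 2 ≤ p) (hf : IsLocLpRepresentative (p - 1) T f)
    (L : EuclideanSpace ℝ (Fin n) →L[ℝ] EuclideanSpace ℝ (Fin n))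
    (b : EuclideanSpace ℝ (Fin n)) {x₀ y ξ : EuclideanSpace ℝ (Fin n)} {R r β : ℝ}
    (hy : y ∈ Metric.ball x₀ (β * R)) (hξ : ξ ∈ T y) (hU : ξ - L y - b ≠ 0)
    (hR : 0 < R) (hr : 0 < r) (hrR : r ≤ 2 / 3 * (1 - β) * R) :
    ‖ξ - L y - b‖ ≤ 2 * deviationConst p lam Lam ‖L‖ *
      max r (((2 * R / r) ^ n * ⨍ x in Metric.ball x₀ R, ‖f x - L x - b‖ ^ (p - 1)) ^
        (1 / (p - 1))) := by
  obtain ⟨e, he, hdev⟩ := hT.exists_direction_norm_le H hp L b hξ hU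
  set K := deviationConst p lam Lam ‖L‖ with hKdef
  have hK : 0 < K := deviationConst_pos H.lam_pos H.Lam_pos (norm_nonneg L)
  have hp1 : 0 < p - 1 := by linarith
  set U := ξ - L y - b
  -- Past this case `K * r ≤ ‖U‖ / 2`, so the term `r` is absorbed and every deviation on the small
  -- ball is at least `‖U‖ / (2 * K)`.
  rcases le_total ‖U‖ (2 * K * r) with hle | hle
  · exact hle.trans (by gcongr; exact le_max_left _ _)
  -- The small ball reaches at most `β * R + r + r / 2` from `x₀`; this is where the factor `2 / 3 *
  -- (1 - β)` comes from.
  have hsub : Metric.ball (y + r • e) (r / 2) ⊆ Metric.ball x₀ R := by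
    refine Metric.ball_subset_ball' ?_
    have h1 : dist (y + r • e) x₀ ≤ dist y x₀ + r := by
      rw [dist_eq_norm, dist_eq_norm, add_sub_right_comm]
      refine (norm_add_le _ _).trans_eq ?_
      rw [norm_smul, he, mul_one, Real.norm_of_nonneg hr.le]
    have := Metric.mem_ball.1 hy
    linarith
  have hc : ∀ᵐ x, x ∈ Metric.ball (y + r • e) (r / 2) →
      (‖U‖ / (2 * K)) ^ (p - 1) ≤ ‖f x - L x - b‖ ^ (p - 1) := by
    filter_upwards [hf.1] with x hx hxb
    refine Real.rpow_le_rpow (by positivity) ?_ hp1.le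
    have := hdev r hr x hxb _ hx
    rw [div_le_iff₀ (by positivity)]
    linarith
  have havg := le_mul_setAverage_ball (fun x => by positivity) (half_pos hr) hR
    (hf.integrableOn_rpow_norm hp1 L b x₀ R) hsub hc
  rw [show R / (r / 2) = 2 * R / r by field_simp] at havg
  have h3 := Real.rpow_le_rpow (by positivity) havg (one_div_pos.2 hp1).le
  rw [← Real.rpow_mul (by positivity), mul_one_div_cancel hp1.ne', Real.rpow_one,
    div_le_iff₀' (by positivity)] at h3
  exact h3.trans (by gcongr; exact le_max_right _ _)

end

/-! ### Choice of the radius -/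

theorem mainTheorem1 (n : ℕ) (p : ℝ) (hp : 2 ≤ p) :
    -- `C` depends on `n, p, β`; `K₁` on `n, p, lam, Lam, ‖A‖`; `K₂` on these and `β`
    ∃ (C : ℝ → ℝ) (K₁ : ℝ → ℝ → ℝ → ℝ) (K₂ : ℝ → ℝ → ℝ → ℝ → ℝ),
      (∀ β : ℝ, 0 < β → β < 1 → 0 < C β) ∧
      ∀ (lam Lam : ℝ) (h : EuclideanSpace ℝ (Fin n) → ℝ)
        (T : EuclideanSpace ℝ (Fin n) → Set (EuclideanSpace ℝ (Fin n)))
        (f : EuclideanSpace ℝ (Fin n) → EuclideanSpace ℝ (Fin n))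
        (A : Matrix (Fin n) (Fin n) ℝ) (b : EuclideanSpace ℝ (Fin n)) (β : ℝ)
        (x₀ : EuclideanSpace ℝ (Fin n)) (R : ℝ),
        IsEllipticCost p lam Lam h → HMonotone h T → IsLocLpRepresentative (p - 1) T f →
        0 < β → β < 1 → 0 < R →
        let L : EuclideanSpace ℝ (Fin n) →L[ℝ] EuclideanSpace ℝ (Fin n) :=
          Matrix.toEuclideanCLM (𝕜 := ℝ) A
        let avg : ℝ := ⨍ x in Metric.ball x₀ R, ‖f x - L x - b‖ ^ (p - 1)
        (avg ^ (1 / (p - 1)) ≤ C β * R →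
          ∀ y ∈ Metric.ball x₀ (β * R), ∀ ξ ∈ T y,
            ‖ξ - L y - b‖ ≤
              K₁ lam Lam ‖L‖ * R * (R ^ (-(p - 1)) * avg) ^ (1 / ((n : ℝ) + p - 1))) ∧
        (C β * R ≤ avg ^ (1 / (p - 1)) →
          ∀ y ∈ Metric.ball x₀ (β * R), ∀ ξ ∈ T y,
            ‖ξ - L y - b‖ ≤
              K₂ lam Lam ‖L‖ β * R * (R ^ (-(p - 1)) * avg) ^ (1 / (p - 1))) := by
  have hp1 : 0 < p - 1 := by linarith
  have hnp : 0 < (n : ℝ) + p - 1 := by have : (0 : ℝ) ≤ n := n.cast_nonneg; linarith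
  set ρ : ℝ → ℝ := fun β => 2 / 3 * (1 - β) with hρ
  -- With this threshold the small regime is exactly the one where the balancing radius `t * R`
  -- below satisfies `t ≤ ρ β`.
  set C : ℝ → ℝ := fun β => ρ β ^ (((n : ℝ) + p - 1) / (p - 1)) with hC
  refine ⟨C, fun lam Lam a => 2 * deviationConst p lam Lam a * (2 ^ n) ^ (1 / (p - 1)),
    fun lam Lam a β => 2 * deviationConst p lam Lam a *
      (ρ β / C β + ((2 / ρ β) ^ n) ^ (1 / (p - 1))), fun β _ hβ => ?_, ?_⟩
  · have : 0 < 1 - β := by linarith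
    positivity
  intro lam Lam h T f A b β x₀ R H hT hf _ hβ hR L avg
  have hρβ : 0 < ρ β := by have : 0 < 1 - β := by linarith
                           positivity
  have hCβ : 0 < C β := Real.rpow_pos_of_pos hρβ _
  have hK : 0 < deviationConst p lam Lam ‖L‖ :=
    deviationConst_pos H.lam_pos H.Lam_pos (norm_nonneg L)
  have havg : 0 ≤ avg := by
    simp only [avg, setAverage_eq]
    exact smul_nonneg (by positivity) (integral_nonneg fun x => by positivity)
  have hscale : R * (R ^ (-(p - 1)) * avg) ^ (1 / (p - 1)) = avg ^ (1 / (p - 1)) := by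
    rw [Real.mul_rpow (by positivity) havg, ← Real.rpow_mul hR.le, neg_mul,
      mul_one_div_cancel hp1.ne', Real.rpow_neg_one, mul_inv_cancel_left₀ hR.ne']
  have main : ∀ y ∈ Metric.ball x₀ (β * R), ∀ ξ ∈ T y, ξ - L y - b ≠ 0 → ∀ r, 0 < r →
      r ≤ ρ β * R → ‖ξ - L y - b‖ ≤ 2 * deviationConst p lam Lam ‖L‖ *
        max r (((2 * R / r) ^ n * avg) ^ (1 / (p - 1))) := fun y hy ξ hξ hU r hr hrR =>
    hT.norm_le_max H hp hf L b hy hξ hU hR hr hrR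
  set m := R ^ (-(p - 1)) * avg with hm
  have hm0 : 0 ≤ m := by positivity
  refine ⟨fun hsmall y hy ξ hξ => ?_, fun hlarge y hy ξ hξ => ?_⟩
  · by_cases hU : ξ - L y - b = 0
    · rw [hU, norm_zero]; positivity
    rcases hm0.eq_or_lt with hmz | hmpos
    -- When the average vanishes the balancing radius would be `0`. A small positive radius instead
    -- yields `‖ξ - L y - b‖ ≤ ‖ξ - L y - b‖ / 2`.
    · exfalso
      have havg0 : avg = 0 := by
        rcases mul_eq_zero.1 hmz.symm with h0 | h0
        · exact absurd h0 (Real.rpow_pos_of_pos hR _).ne'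
        · exact h0
      have hUpos : 0 < ‖ξ - L y - b‖ := norm_pos_iff.2 hU
      set r := min (ρ β * R) (‖ξ - L y - b‖ / (4 * deviationConst p lam Lam ‖L‖)) with hr
      have hrpos : 0 < r := lt_min (by positivity) (by positivity)
      have h1 := main y hy ξ hξ hU r hrpos (min_le_left _ _)
      rw [havg0, mul_zero, Real.zero_rpow (one_div_pos.2 hp1).ne', max_eq_left hrpos.le] at h1
      have h2 : r ≤ ‖ξ - L y - b‖ / (4 * deviationConst p lam Lam ‖L‖) := min_le_right _ _
      rw [le_div_iff₀ (by positivity)] at h2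
      linarith
    -- At `r = t * R`, and up to the factor `2 ^ n`, the terms `r ^ (p - 1)` and `(2 * R / r) ^ n *
    -- avg` agree exactly when `t ^ (n + p - 1) = m`.
    · set t := m ^ (1 / ((n : ℝ) + p - 1)) with ht
      have htpos : 0 < t := Real.rpow_pos_of_pos hmpos _
      have hmC : m ^ (1 / (p - 1)) ≤ C β := by
        refine le_of_mul_le_mul_left ?_ hR
        rw [hscale]; linarith
      have htρ : t ≤ ρ β := by
        have h1 := Real.rpow_le_rpow (by positivity) hmC
          (show 0 ≤ (p - 1) / ((n : ℝ) + p - 1) by positivity)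
        rw [← Real.rpow_mul hm0, hC, ← Real.rpow_mul hρβ.le,
          show 1 / (p - 1) * ((p - 1) / ((n : ℝ) + p - 1)) = 1 / ((n : ℝ) + p - 1) by field_simp,
          show ((n : ℝ) + p - 1) / (p - 1) * ((p - 1) / ((n : ℝ) + p - 1)) = 1 by field_simp,
          Real.rpow_one] at h1
        exact h1
      have hmt : m = t ^ n * t ^ (p - 1) := by
        rw [← Real.rpow_natCast, ← Real.rpow_add htpos, ht, ← Real.rpow_mul hm0,
          ← add_sub_assoc, one_div_mul_cancel hnp.ne', Real.rpow_one]
      have havgm : avg = R ^ (p - 1) * m := by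
        rw [hm, ← mul_assoc, ← Real.rpow_add hR, add_neg_cancel, Real.rpow_zero, one_mul]
      have h1 := main y hy ξ hξ hU (t * R) (by positivity) (by gcongr)
      have h2 : ((2 * R / (t * R)) ^ n * avg) ^ (1 / (p - 1)) =
          (2 ^ n) ^ (1 / (p - 1)) * (R * t) := by
        have h3 : (2 * R / (t * R)) ^ n * avg = 2 ^ n * (R * t) ^ (p - 1) := by
          rw [mul_div_mul_right _ _ hR.ne', div_pow, havgm, hmt, Real.mul_rpow hR.le htpos.le]
          field_simp
        rw [h3, Real.mul_rpow (by positivity) (by positivity), ← Real.rpow_mul (by positivity),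
          mul_one_div_cancel hp1.ne', Real.rpow_one]
      have h4 : (1 : ℝ) ≤ (2 ^ n) ^ (1 / (p - 1)) :=
        Real.one_le_rpow (one_le_pow₀ (by norm_num)) (by positivity)
      have h5 : max (t * R) ((2 ^ n) ^ (1 / (p - 1)) * (R * t)) ≤
          (2 ^ n) ^ (1 / (p - 1)) * (R * t) := by
        refine max_le ?_ le_rfl
        rw [mul_comm t R]
        exact le_mul_of_one_le_left (by positivity) h4
      rw [h2] at h1
      calc _ ≤ _ := h1
        _ ≤ 2 * deviationConst p lam Lam ‖L‖ * ((2 ^ n) ^ (1 / (p - 1)) * (R * t)) := by gcongr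
        _ = _ := by ring
  · rw [mul_assoc, hscale]
    by_cases hU : ξ - L y - b = 0
    · rw [hU, norm_zero]; positivity
    have h1 := main y hy ξ hξ hU (ρ β * R) (by positivity) le_rfl
    rw [mul_div_mul_right _ _ hR.ne', Real.mul_rpow (by positivity) havg] at h1
    refine h1.trans ?_
    rw [mul_assoc _ (_ + _)]
    refine mul_le_mul_of_nonneg_left ?_ (by positivity)
    -- In the large regime the radius itself is controlled by the average, which explains the
    -- summand `ρ β / C β` in `K₂`.
    have h2 : ρ β * R ≤ ρ β / C β * avg ^ (1 / (p - 1)) := by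
      rw [div_mul_eq_mul_div, le_div_iff₀ hCβ]
      nlinarith
    have h3 : 0 ≤ avg ^ (1 / (p - 1)) := by positivity
    rw [add_mul]
    exact max_le (h2.trans (le_add_of_nonneg_right (by positivity)))
      (le_add_of_nonneg_left (by positivity))
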